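/- Let $$\begin{array}{ccccc}\tilde A & \xleftarrow{\;\phi_{\tilde A}\;} & \tilde D & \xrightarrow{\;\phi_{\tilde B}\;} & \tilde B\\ {\scriptstyle\lambda_A}\uparrow & & {\scriptstyle\lambda_D}\uparrow & & \uparrow{\scriptstyle\lambda_B}\\ A & \xleftarrow{\;\phi_A\;} & D & \xrightarrow{\;\phi_B\;} & B\end{array}$$ be a commuting diagram of (not necessarily unital) complex C$^*$-algebras and injective $*$-homomorphisms, all regarded as inclusions. Let $A*_DB$ be the full amalgamated free product: the C$^*$-algebra generated by copies $\sigma_A(A)\cup\sigma_B(B)$, where $\sigma_A:A\to A*_DB$ and $\sigma_B:B\to A*_DB$ are $*$-homomorphisms with $\sigma_A\circ\phi_A=\sigma_B\circ\phi_B$, that is universal for pairs of $*$-homomorphisms $\pi_A:A\to\mathfrak C$, $\pi_B:B\to\mathfrak C$ into a C$^*$-algebra with $\pi_A\circ\phi_A=\pi_B\circ\phi_B$. Define $\tilde A*_{\tilde D}\tilde B$ similarly, and let $\lambda:A*_DB\to\tilde A*_{\tilde D}\tilde B$ be the $*$-homomorphism with $\lambda\circ\sigma_A=\sigma_{\tilde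 A}\circ\lambda_A$ and $\lambda\circ\sigma_B=\sigma_{\tilde B}\circ\lambda_B$ given by the universal property. Suppose that one of the following holds: (i) $D=0$; (ii) $D=\mathbb C$, $A$ and $B$ are unital, and the inclusions $D\hookrightarrow A$ and $D\hookrightarrow B$ are unital. Suppose that there are $\tilde d\in\tilde D$, $a\in A$ and $b\in B$ such that $a\tilde d\in A\setminus\{0\}$, $\tilde d b\in B$ and $\tilde d b\notin\mathbb C b$ (the products being taken in $\tilde A$ and in $\tilde B$, respectively). Then $\lambda$ is not injective. -/

import Mathlib

open scoped ENNReal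

noncomputable section

universe u v w u' v' w' x

namespace FullFree

section Construction

variable {A : Type u} {B : Type v} {D : Type w}
  [NonUnitalCStarAlgebra A] [NonUnitalCStarAlgebra B] [NonUnitalCStarAlgebra D]

/-- A pair of `*`-homomorphisms of `A` and `B` into a common C⋆-algebra `C` which agree on `D`
(that is, `π_A ∘ φ_A = π_B ∘ φ_B`).  The algebra `C` ranges over all C⋆-algebras in the universe of
`A` and `B`. -/
structure Cocone (φA : D →⋆ₙₐ[ℂ] A) (φB : D →⋆ₙₐ[ℂ] B) where
  C : Type (max u v)
  [inst : NonUnitalCStarAlgebra C]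
  πA : A →⋆ₙₐ[ℂ] C
  πB : B →⋆ₙₐ[ℂ] C
  comm : ∀ d, πA (φA d) = πB (φB d)

instance (φA : D →⋆ₙₐ[ℂ] A) (φB : D →⋆ₙₐ[ℂ] B) (i : Cocone φA φB) :
    NonUnitalCStarAlgebra i.C := i.inst

variable (φA : D →⋆ₙₐ[ℂ] A) (φB : D →⋆ₙₐ[ℂ] B)

/-- The C⋆-algebra of bounded families indexed by all cocones. -/
abbrev Big : Type (max (u + 1) (v + 1)) := lp (fun i : Cocone φA φB => i.C) ∞

/-- A bounded family of `*`-homomorphisms, as a `*`-homomorphism into the bounded families. -/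
def bigOf {E : Type*} [NonUnitalCStarAlgebra E] (f : ∀ i : Cocone φA φB, E →⋆ₙₐ[ℂ] i.C) :
    E →⋆ₙₐ[ℂ] Big φA φB where
  toFun a := ⟨fun i => f i a, memℓp_infty ⟨‖a‖, by
    rintro _ ⟨i, rfl⟩
    exact NonUnitalStarAlgHom.norm_apply_le (f i) a⟩⟩
  map_smul' c a := by ext i; exact map_smul (f i) c a
  map_zero' := by ext i; exact map_zero (f i)
  map_add' a b := by ext i; exact map_add (f i) a b
  map_mul' a b := by ext i; exact map_mul (f i) a b
  map_star' a := by ext i; exact map_star (f i) a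

/-- The `i`-th coordinate, as a `*`-homomorphism. -/
def coord (i : Cocone φA φB) : Big φA φB →⋆ₙₐ[ℂ] i.C where
  toFun f := f i
  map_smul' _ _ := rfl
  map_zero' := rfl
  map_add' _ _ := rfl
  map_mul' _ _ := rfl
  map_star' _ := rfl

/-- `A → Big`, `a ↦ (π_A(a))`, over all cocones. -/
def bigA : A →⋆ₙₐ[ℂ] Big φA φB := bigOf φA φB fun i => i.πA

/-- `B → Big`, `b ↦ (π_B(b))`, over all cocones. -/
def bigB : B →⋆ₙₐ[ℂ] Big φA φB := bigOf φA φB fun i => i.πB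

end Construction

/-- The C⋆-subalgebra generated by a set. -/
def generated {E : Type*} [NonUnitalCStarAlgebra E] (s : Set E) : NonUnitalStarSubalgebra ℂ E :=
  (NonUnitalStarAlgebra.adjoin ℂ s).topologicalClosure

instance {E : Type*} [NonUnitalCStarAlgebra E] (s : Set E) :
    IsClosed (generated s : Set E) :=
  NonUnitalStarSubalgebra.isClosed_topologicalClosure _

lemma subset_generated {E : Type*} [NonUnitalCStarAlgebra E] (s : Set E) :
    s ⊆ (generated s : Set E) :=
  (NonUnitalStarAlgebra.subset_adjoin ℂ s).trans
    (NonUnitalStarSubalgebra.le_topologicalClosure _)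

/-- Two `*`-homomorphisms that agree on a set agree on the C⋆-subalgebra it generates. -/
lemma eqOn_generated {E F : Type*} [NonUnitalCStarAlgebra E] [NonUnitalCStarAlgebra F]
    {s : Set E} {t : NonUnitalStarSubalgebra ℂ E} [IsClosed (t : Set E)] (ht : t = generated s)
    (f g : t →⋆ₙₐ[ℂ] F)
    (h : ∀ y : t, (y : E) ∈ s → f y = g y) : f = g := by
  subst ht
  have homcont (k : generated s →⋆ₙₐ[ℂ] F) : Continuous k :=
    (AddMonoidHomClass.lipschitz_of_bound k 1 fun y => by
      simpa using NonUnitalStarAlgHom.norm_apply_le k y).continuous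
  have hcl : IsClosed {y : generated s | f y = g y} :=
    isClosed_eq (homcont f) (homcont g)
  have key : ∀ y (hy : y ∈ NonUnitalStarAlgebra.adjoin ℂ s),
      f ⟨y, NonUnitalStarSubalgebra.le_topologicalClosure _ hy⟩ =
      g ⟨y, NonUnitalStarSubalgebra.le_topologicalClosure _ hy⟩ := by
    intro y hy
    induction hy using NonUnitalStarAlgebra.adjoin_induction with
    | mem y hy => exact h ⟨y, _⟩ hy
    | add a b ha hb iha ihb =>
      exact (map_add f ⟨a, _⟩ ⟨b, _⟩).trans ((congrArg₂ _ iha ihb).trans (map_add g _ _).symm)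
    | zero => exact (map_zero f).trans (map_zero g).symm
    | mul a b ha hb iha ihb =>
      exact (map_mul f ⟨a, _⟩ ⟨b, _⟩).trans ((congrArg₂ _ iha ihb).trans (map_mul g _ _).symm)
    | smul c a ha iha =>
      exact (map_smul f c ⟨a, _⟩).trans ((congrArg _ iha).trans (map_smul g c _).symm)
    | star a ha iha =>
      exact (map_star f ⟨a, _⟩).trans ((congrArg _ iha).trans (map_star g _).symm)
  ext ⟨y, hy⟩
  obtain ⟨z, hz, hzy⟩ := mem_closure_iff_seq_limit.1 hy
  have hlim : Filter.Tendsto (fun n : ℕ =>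
      (⟨z n, NonUnitalStarSubalgebra.le_topologicalClosure _ (hz n)⟩ : generated s))
      Filter.atTop (nhds ⟨y, hy⟩) := tendsto_subtype_rng.2 hzy
  exact hcl.mem_of_tendsto hlim (Filter.Eventually.of_forall fun n => key _ (hz n))

section FreeProduct

variable {A : Type u} {B : Type v} {D : Type w}
  [NonUnitalCStarAlgebra A] [NonUnitalCStarAlgebra B] [NonUnitalCStarAlgebra D]
  (φA : D →⋆ₙₐ[ℂ] A) (φB : D →⋆ₙₐ[ℂ] B)

/-- The full amalgamated free product `A *_D B` of C⋆-algebras with respect to `φ_A : D → A` and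
`φ_B : D → B`: the C⋆-algebra generated by the canonical copies of `A` and `B` in the bounded
families over all cocones.  In other words, it carries the largest C⋆-norm coming from pairs of
`*`-homomorphisms of `A` and `B` that agree on `D`.  Its universal property, with respect to
C⋆-algebras in every universe, is `existsUnique_lift` below. -/
def FreeProduct : Type (max (u + 1) (v + 1)) :=
  generated (Set.range (bigA φA φB) ∪ Set.range (bigB φA φB))

instance : NonUnitalCStarAlgebra (FreeProduct φA φB) :=
  inferInstanceAs (NonUnitalCStarAlgebra
    (generated (Set.range (bigA φA φB) ∪ Set.range (bigB φA φB))))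

/-- The canonical map `σ_A : A → A *_D B`. -/
def inl : A →⋆ₙₐ[ℂ] FreeProduct φA φB :=
  NonUnitalStarAlgHom.codRestrict (bigA φA φB)
    (generated (Set.range (bigA φA φB) ∪ Set.range (bigB φA φB)))
    fun a => subset_generated _ (Or.inl ⟨a, rfl⟩)

/-- The canonical map `σ_B : B → A *_D B`. -/
def inr : B →⋆ₙₐ[ℂ] FreeProduct φA φB :=
  NonUnitalStarAlgHom.codRestrict (bigB φA φB)
    (generated (Set.range (bigA φA φB) ∪ Set.range (bigB φA φB)))
    fun b => subset_generated _ (Or.inr ⟨b, rfl⟩)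

theorem inl_comp_eq (d : D) : inl φA φB (φA d) = inr φA φB (φB d) := by
  apply Subtype.ext
  ext i
  exact i.comm d

/-- `*`-homomorphisms on `A *_D B` are determined on the copies of `A` and `B`. -/
theorem hom_ext {C : Type x} [NonUnitalCStarAlgebra C] {f g : FreeProduct φA φB →⋆ₙₐ[ℂ] C}
    (hA : ∀ a, f (inl φA φB a) = g (inl φA φB a))
    (hB : ∀ b, f (inr φA φB b) = g (inr φA φB b)) : f = g := by
  refine eqOn_generated (s := Set.range (bigA φA φB) ∪ Set.range (bigB φA φB)) rfl f g ?_
  rintro ⟨y, hy⟩ (⟨a, rfl⟩ | ⟨b, rfl⟩)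
  · exact hA a
  · exact hB b

/-- The coordinate of `A *_D B` at a cocone. -/
def evalAt (i : Cocone φA φB) : FreeProduct φA φB →⋆ₙₐ[ℂ] i.C :=
  (coord φA φB i).comp (NonUnitalStarSubalgebraClass.subtype
    (generated (Set.range (bigA φA φB) ∪ Set.range (bigB φA φB))))

end FreeProduct

section Small

/-- Formal `*`-polynomials without constant term in the elements of `A` and `B`. -/
inductive Word (A : Type u) (B : Type v) : Type (max u v)
  | ofA (a : A) : Word A B
  | ofB (b : B) : Word A B
  | zero : Word A B
  | add (p q : Word A B) : Word A B
  | mul (p q : Word A B) : Word A B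
  | smul (c : ℂ) (p : Word A B) : Word A B
  | star (p : Word A B) : Word A B

variable {A : Type u} {B : Type v} {C : Type x} [NonUnitalCStarAlgebra C]

/-- Evaluation of formal `*`-polynomials. -/
def Word.eval (f : A → C) (g : B → C) : Word A B → C
  | .ofA a => f a
  | .ofB b => g b
  | .zero => 0
  | .add p q => p.eval f g + q.eval f g
  | .mul p q => p.eval f g * q.eval f g
  | .smul c p => c • p.eval f g
  | .star p => Star.star (p.eval f g)

/-- The C⋆-algebra generated by images of `A` and `B` fits in the universe of `A` and `B`. -/
lemma small_generated (f : A → C) (g : B → C) :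
    Small.{max u v} (generated (Set.range f ∪ Set.range g)) := by
  have hmem : ∀ y ∈ NonUnitalStarAlgebra.adjoin ℂ (Set.range f ∪ Set.range g),
      ∃ p : Word A B, p.eval f g = y := by
    intro y hy
    induction hy using NonUnitalStarAlgebra.adjoin_induction with
    | mem y hy =>
      rcases hy with ⟨a, rfl⟩ | ⟨b, rfl⟩
      · exact ⟨.ofA a, rfl⟩
      · exact ⟨.ofB b, rfl⟩
    | add a b ha hb iha ihb =>
      obtain ⟨p, rfl⟩ := iha; obtain ⟨q, rfl⟩ := ihb; exact ⟨.add p q, rfl⟩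
    | zero => exact ⟨.zero, rfl⟩
    | mul a b ha hb iha ihb =>
      obtain ⟨p, rfl⟩ := iha; obtain ⟨q, rfl⟩ := ihb; exact ⟨.mul p q, rfl⟩
    | smul c a ha iha => obtain ⟨p, rfl⟩ := iha; exact ⟨.smul c p, rfl⟩
    | star a ha iha => obtain ⟨p, rfl⟩ := iha; exact ⟨.star p, rfl⟩
  refine small_of_injective (β := Set (Word A B × ℝ))
    (f := fun y => {pr | dist (y : C) (pr.1.eval f g) < pr.2}) ?_
  rintro ⟨y, hy⟩ ⟨z, hz⟩ hyz
  refine Subtype.ext (eq_of_forall_dist_le fun ε hε => ?_)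
  obtain ⟨t, ht, hyt⟩ := Metric.mem_closure_iff.1 hy (ε / 2) (half_pos hε)
  obtain ⟨p, rfl⟩ := hmem t ht
  have h1 : (p, ε / 2) ∈ {pr : Word A B × ℝ | dist z (pr.1.eval f g) < pr.2} := by
    have := Set.ext_iff.1 hyz (p, ε / 2)
    exact this.1 hyt
  have h2 : dist z (p.eval f g) < ε / 2 := h1
  have := dist_triangle_right y z (p.eval f g)
  linarith

/-- A small C⋆-algebra is `*`-isomorphic to one in the smaller universe. -/
lemma exists_shrink (E : Type x) [NonUnitalCStarAlgebra E] [Small.{u} E] :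
    ∃ (F : Type u) (_ : NonUnitalCStarAlgebra F) (f : E →⋆ₙₐ[ℂ] F) (g : F →⋆ₙₐ[ℂ] E),
      ∀ y, g (f y) = y := by
  let e : Shrink.{u} E ≃ E := (equivShrink E).symm
  let : NonUnitalRing (Shrink.{u} E) := e.nonUnitalRing
  let : Module ℂ (Shrink.{u} E) := e.module ℂ
  have eadd : ∀ a b, e (a + b) = e a + e b := fun a b => e.apply_symm_apply _
  have emul : ∀ a b, e (a * b) = e a * e b := fun a b => e.apply_symm_apply _
  have ezero : e 0 = 0 := e.apply_symm_apply _
  have esmul : ∀ (c : ℂ) a, e (c • a) = c • e a := fun c a => e.apply_symm_apply _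
  let er : Shrink.{u} E →ₙ+* E :=
    { toFun := e, map_add' := eadd, map_mul' := emul, map_zero' := ezero }
  let nr : NonUnitalNormedRing (Shrink.{u} E) := NonUnitalNormedRing.induced _ _ er e.injective
  have enorm : ∀ a, ‖e a‖ = ‖a‖ := fun a => rfl
  have eiso : Isometry e := AddMonoidHomClass.isometry_of_norm er enorm
  let sr : StarRing (Shrink.{u} E) :=
    { star := fun a => e.symm (star (e a))
      star_involutive := fun a => by apply e.injective; simp
      star_mul := fun a b => by
        apply e.injective
        change e (e.symm (star (e (a * b)))) =
          e ((e.symm (star (e b))) * (e.symm (star (e a))))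
        simp [emul]
      star_add := fun a b => by
        apply e.injective
        change e (e.symm (star (e (a + b)))) =
          e ((e.symm (star (e a))) + (e.symm (star (e b))))
        simp [eadd] }
  have estar : ∀ a, e (star a) = star (e a) := fun a => e.apply_symm_apply _
  have hcomplete : CompleteSpace (Shrink.{u} E) :=
    (completeSpace_iff_isComplete_range eiso.isUniformInducing).2
      (by rw [e.surjective.range_eq]; exact isComplete_univ)
  have hcstar : CStarRing (Shrink.{u} E) :=
    ⟨fun a => by
      rw [← enorm, ← enorm, emul, estar]
      exact CStarRing.norm_mul_self_le (e a)⟩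
  let ns : NormedSpace ℂ (Shrink.{u} E) :=
    { norm_smul_le := fun c a => by
        change ‖e (c • a)‖ ≤ ‖c‖ * ‖e a‖
        rw [esmul]; exact norm_smul_le c (e a) }
  have h1 : IsScalarTower ℂ (Shrink.{u} E) (Shrink.{u} E) :=
    ⟨fun c a b => e.injective (by
      simp [smul_eq_mul, emul, esmul, smul_mul_assoc])⟩
  have h2 : SMulCommClass ℂ (Shrink.{u} E) (Shrink.{u} E) :=
    ⟨fun c a b => e.injective (by
      simp [smul_eq_mul, emul, esmul, mul_smul_comm])⟩
  have h3 : StarModule ℂ (Shrink.{u} E) :=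
    ⟨fun c a => e.injective (by simp [estar, esmul])⟩
  refine ⟨Shrink.{u} E,
    { nr, sr, ns with
      complete := hcomplete.complete
      norm_mul_self_le := hcstar.norm_mul_self_le
      smul_assoc := h1.smul_assoc
      smul_comm := h2.smul_comm
      star_smul := h3.star_smul }, ?_, ?_, ?_⟩
  · exact
      { toFun := e.symm
        map_smul' := fun c a => e.injective (by simp [esmul])
        map_zero' := e.injective (by simp [ezero])
        map_add' := fun a b => e.injective (by simp [eadd])
        map_mul' := fun a b => e.injective (by simp [emul])
        map_star' := fun a => e.injective (by simp [estar]) }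
  · exact
      { toFun := e
        map_smul' := esmul
        map_zero' := ezero
        map_add' := eadd
        map_mul' := emul
        map_star' := estar }
  · exact fun y => e.apply_symm_apply y

end Small

section Universal

variable {A : Type u} {B : Type v} {D : Type w}
  [NonUnitalCStarAlgebra A] [NonUnitalCStarAlgebra B] [NonUnitalCStarAlgebra D]
  (φA : D →⋆ₙₐ[ℂ] A) (φB : D →⋆ₙₐ[ℂ] B)

/-- The universal property of `A *_D B`, with respect to C⋆-algebras in an arbitrary universe. -/
theorem existsUnique_lift {C : Type x} [NonUnitalCStarAlgebra C]
    (πA : A →⋆ₙₐ[ℂ] C) (πB : B →⋆ₙₐ[ℂ] C) (h : ∀ d, πA (φA d) = πB (φB d)) :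
    ∃! π : FreeProduct φA φB →⋆ₙₐ[ℂ] C,
      (∀ a, π (inl φA φB a) = πA a) ∧ ∀ b, π (inr φA φB b) = πB b := by
  refine existsUnique_of_exists_of_unique ?_ fun f g hf hg =>
    hom_ext φA φB (fun a => (hf.1 a).trans (hg.1 a).symm) fun b => (hf.2 b).trans (hg.2 b).symm
  let S := generated (Set.range πA ∪ Set.range πB)
  have : Small.{max u v} S := small_generated πA πB
  obtain ⟨F, instF, f, g, hgf⟩ := exists_shrink.{max u v} S
  let ρA : A →⋆ₙₐ[ℂ] S :=
    NonUnitalStarAlgHom.codRestrict πA S fun a => subset_generated _ (Or.inl ⟨a, rfl⟩)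
  let ρB : B →⋆ₙₐ[ℂ] S :=
    NonUnitalStarAlgHom.codRestrict πB S fun b => subset_generated _ (Or.inr ⟨b, rfl⟩)
  let i : Cocone φA φB :=
    { C := F
      πA := f.comp ρA
      πB := f.comp ρB
      comm := fun d => congrArg f (Subtype.ext (h d)) }
  refine ⟨((NonUnitalStarSubalgebraClass.subtype S).comp g).comp (evalAt φA φB i), ?_, ?_⟩
  · intro a
    exact congrArg Subtype.val (hgf (ρA a))
  · intro b
    exact congrArg Subtype.val (hgf (ρB b))

/-- The `*`-homomorphism `π : A *_D B → C` arising from `π_A` and `π_B` via the universal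
property. -/
def lift {C : Type x} [NonUnitalCStarAlgebra C]
    (πA : A →⋆ₙₐ[ℂ] C) (πB : B →⋆ₙₐ[ℂ] C) (h : ∀ d, πA (φA d) = πB (φB d)) :
    FreeProduct φA φB →⋆ₙₐ[ℂ] C :=
  (existsUnique_lift φA φB πA πB h).choose

theorem lift_inl {C : Type x} [NonUnitalCStarAlgebra C]
    (πA : A →⋆ₙₐ[ℂ] C) (πB : B →⋆ₙₐ[ℂ] C) (h : ∀ d, πA (φA d) = πB (φB d)) (a : A) :
    lift φA φB πA πB h (inl φA φB a) = πA a :=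
  (existsUnique_lift φA φB πA πB h).choose_spec.1.1 a

theorem lift_inr {C : Type x} [NonUnitalCStarAlgebra C]
    (πA : A →⋆ₙₐ[ℂ] C) (πB : B →⋆ₙₐ[ℂ] C) (h : ∀ d, πA (φA d) = πB (φB d)) (b : B) :
    lift φA φB πA πB h (inr φA φB b) = πB b :=
  (existsUnique_lift φA φB πA πB h).choose_spec.1.2 b

variable {At : Type u'} {Bt : Type v'} {Dt : Type w'}
  [NonUnitalCStarAlgebra At] [NonUnitalCStarAlgebra Bt] [NonUnitalCStarAlgebra Dt]
  (φAt : Dt →⋆ₙₐ[ℂ] At) (φBt : Dt →⋆ₙₐ[ℂ] Bt)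

/-- The `*`-homomorphism `λ : A *_D B → Ã *_D̃ B̃` arising, via the universal property, from the
vertical maps of a commuting diagram: `λ ∘ σ_A = σ_Ã ∘ λ_A` and `λ ∘ σ_B = σ_B̃ ∘ λ_B`. -/
def map (lA : A →⋆ₙₐ[ℂ] At) (lB : B →⋆ₙₐ[ℂ] Bt) (lD : D →⋆ₙₐ[ℂ] Dt)
    (hA : ∀ d, lA (φA d) = φAt (lD d)) (hB : ∀ d, lB (φB d) = φBt (lD d)) :
    FreeProduct φA φB →⋆ₙₐ[ℂ] FreeProduct φAt φBt :=
  lift φA φB ((inl φAt φBt).comp lA) ((inr φAt φBt).comp lB) fun d => by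
    change inl φAt φBt (lA (φA d)) = inr φAt φBt (lB (φB d))
    rw [hA, hB, inl_comp_eq]

end Universal

/-- `e` is a two-sided multiplicative identity of `A`. -/
def IsIdentity {A : Type*} [Mul A] (e : A) : Prop := ∀ a : A, e * a = a ∧ a * e = a

end FullFree

end

noncomputable section

open scoped TensorProduct ComplexOrder InnerProductSpace ComplexStarModule

namespace FullFree

/-! Write `a'` for a·d and `b'` for d·b. Since d lies in both algebras of the upper row, a'·b =
a·d·b = a·b' in the larger free product. If λ were injective, a'·b = a·b' would already hold in A
*_D B. There it fails: when D is 0 or ℂ, representations of A on H and of B on K give a compatible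
pair π_A ⊗ Q, P ⊗ π_B on H ⊗ K, under which a·b goes to π_A(a) ⊗ π_B(b) (`exists_projections`,
`tensorOp_mul`). So a' ⊗ b = a ⊗ b' at the level of operators, and a' ≠ 0 makes b a scalar multiple
of b' (`exists_smul_eq_of_inl_mul_inr_eq`); the scalar turns out to be invertible unless b' = 0, so
b' ∈ ℂb either way, a contradiction. -/

/-! ### Positive functionals and GNS representations. -/

/-- A nonzero positive element is detected by a positive functional. -/
theorem exists_positiveLinearMap_ne_zero {A : Type*} [NonUnitalCStarAlgebra A] [PartialOrder A]
    [StarOrderedRing A] {c : A} (hc : 0 ≤ c) (hc0 : c ≠ 0) : ∃ f : A →ₚ[ℂ] ℂ, f c ≠ 0 := by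
  -- Hahn–Banach: the positive elements form a closed real cone missing -c, so a real functional is
  -- nonnegative on the cone and negative at -c.
  let K : ProperCone ℝ A := ⟨PointedCone.positive ℝ A, CStarAlgebra.isClosed_nonneg⟩
  have hK (x : A) : x ∈ K ↔ 0 ≤ x := Iff.rfl
  have hneg : -c ∉ K := fun h => hc0 (le_antisymm (neg_nonneg.1 ((hK _).1 h)) hc)
  obtain ⟨f, hf, hfc⟩ := K.hyperplane_separation_point hneg
  -- The complex-linear extension of the restriction of `f` to self-adjoint elements.
  let g : A →ₗ[ℂ] ℂ :=
    { toFun x := (f (ℜ x : A) : ℂ) + Complex.I * (f (ℑ x : A) : ℂ)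
      map_add' x y := by simp; ring
      map_smul' z x := by
        simp [realPart_smul, imaginaryPart_smul]
        apply Complex.ext <;> simp }
  have hg (x : A) (hx : 0 ≤ x) : g x = f x := by
    have h := IsSelfAdjoint.of_nonneg hx
    simp [g, h.coe_realPart, h.imaginaryPart]
  refine ⟨PositiveLinearMap.mk₀ g fun x hx => ?_, fun h => ?_⟩
  · rw [hg x hx]
    exact_mod_cast hf x ((hK x).2 hx)
  · have h : g c = 0 := h
    rw [hg c hc, Complex.ofReal_eq_zero] at h
    simp [h] at hfc

/-- Every nonzero element of a C⋆-algebra is nonzero in some Hilbert space representation. -/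
theorem exists_representation_ne_zero {A : Type u} [NonUnitalCStarAlgebra A] {a : A} (ha : a ≠ 0) :
    ∃ (H : Type u) (_ : NormedAddCommGroup H) (_ : InnerProductSpace ℂ H) (_ : CompleteSpace H)
      (π : A →⋆ₙₐ[ℂ] (H →L[ℂ] H)), π a ≠ 0 := by
  let _ := CStarAlgebra.spectralOrder A
  let _ := CStarAlgebra.spectralOrderedRing A
  -- Without a unit there may be no evident cyclic vector. The class of a* serves instead: π(a)
  -- sends it to the class of aa*, whose squared norm is f((aa*)*(aa*)).
  have h0 : star (a * star a) * (a * star a) ≠ 0 := by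
    rwa [Ne, CStarRing.star_mul_self_eq_zero_iff, CStarRing.mul_star_self_eq_zero_iff]
  obtain ⟨f, hf⟩ := exists_positiveLinearMap_ne_zero (star_mul_self_nonneg (a * star a)) h0
  refine ⟨f.GNS, inferInstance, inferInstance, inferInstance, f.gnsNonUnitalStarAlgHom, fun h => ?_⟩
  have h1 := DFunLike.congr_fun h (f.toPreGNS (star a) : f.GNS)
  have h2 : ‖f.toPreGNS (a * star a)‖ = 0 := by
    rw [← UniformSpace.Completion.norm_coe]
    rw [PositiveLinearMap.gnsNonUnitalStarAlgHom_apply_coe] at h1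
    exact norm_eq_zero.2 h1
  apply hf
  have := f.preGNS_norm_sq (f.toPreGNS (a * star a))
  simpa [h2] using this.symm

/-! ### Operators on Hilbert space tensor products. -/

section Tensor

variable {H K : Type*} [NormedAddCommGroup H] [InnerProductSpace ℂ H]
  [NormedAddCommGroup K] [InnerProductSpace ℂ K]

variable (H K) in
/-- The Hilbert space tensor product. -/
abbrev HilbertTensor := UniformSpace.Completion (H ⊗[ℂ] K)

/-- The tensor product of two bounded operators on the Hilbert space tensor product. -/
def tensorOp (S : H →L[ℂ] H) (T : K →L[ℂ] K) : HilbertTensor H K →L[ℂ] HilbertTensor H K :=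
  (TensorProduct.mapL S T).completion

@[simp] lemma tensorOp_coe (S : H →L[ℂ] H) (T : K →L[ℂ] K) (x : H ⊗[ℂ] K) :
    tensorOp S T (x : HilbertTensor H K) = (TensorProduct.mapL S T x : H ⊗[ℂ] K) :=
  ContinuousLinearMap.completion_apply_coe _ _

lemma hilbertTensor_ext {S T : HilbertTensor H K →L[ℂ] HilbertTensor H K}
    (h : ∀ x : H ⊗[ℂ] K, S x = T x) : S = T := by
  ext x
  induction x using UniformSpace.Completion.induction_on with
  | hp => exact isClosed_eq S.continuous T.continuous
  | ih x => exact h x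

lemma tensorOp_add_left (S S' : H →L[ℂ] H) (T : K →L[ℂ] K) :
    tensorOp (S + S') T = tensorOp S T + tensorOp S' T :=
  hilbertTensor_ext fun x => by
    simp [TensorProduct.mapL_add_left, UniformSpace.Completion.coe_add]

lemma tensorOp_add_right (S : H →L[ℂ] H) (T T' : K →L[ℂ] K) :
    tensorOp S (T + T') = tensorOp S T + tensorOp S T' :=
  hilbertTensor_ext fun x => by
    simp [TensorProduct.map_add_right, UniformSpace.Completion.coe_add]

lemma tensorOp_smul_left (c : ℂ) (S : H →L[ℂ] H) (T : K →L[ℂ] K) :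
    tensorOp (c • S) T = c • tensorOp S T :=
  hilbertTensor_ext fun x => by
    simp [TensorProduct.map_smul_left, UniformSpace.Completion.coe_smul]

lemma tensorOp_smul_right (c : ℂ) (S : H →L[ℂ] H) (T : K →L[ℂ] K) :
    tensorOp S (c • T) = c • tensorOp S T :=
  hilbertTensor_ext fun x => by
    simp [TensorProduct.map_smul_right, UniformSpace.Completion.coe_smul]

lemma tensorOp_mul (S S' : H →L[ℂ] H) (T T' : K →L[ℂ] K) :
    tensorOp S T * tensorOp S' T' = tensorOp (S * S') (T * T') :=
  hilbertTensor_ext fun x => by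
    rw [mul_apply_eq_comp, tensorOp_coe, tensorOp_coe, tensorOp_coe,
      TensorProduct.mapL_mul, mul_apply_eq_comp]

lemma star_tensorOp [CompleteSpace H] [CompleteSpace K] (S : H →L[ℂ] H) (T : K →L[ℂ] K) :
    star (tensorOp S T) = tensorOp (star S) (star T) := by
  symm
  rw [ContinuousLinearMap.star_eq_adjoint (tensorOp S T), ContinuousLinearMap.eq_adjoint_iff]
  intro x y
  -- Both sides are continuous, so algebraic tensors suffice, and by additivity elementary ones.
  induction x, y using UniformSpace.Completion.induction_on₂ with
  | hp => apply isClosed_eq <;> fun_prop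
  | ih x y =>
    rw [tensorOp_coe, tensorOp_coe, UniformSpace.Completion.inner_coe,
      UniformSpace.Completion.inner_coe]
    induction x with
    | zero => simp
    | add x x' hx hx' => simp only [map_add, inner_add_left, hx, hx']
    | tmul h k =>
      induction y with
      | zero => simp
      | add y y' hy hy' => simp only [map_add, inner_add_right, hy, hy']
      | tmul h' k' =>
        simp [ContinuousLinearMap.star_eq_adjoint, ContinuousLinearMap.adjoint_inner_left]

/-- Amplification `a ↦ π(a) ⊗ Q` of a representation by a projection `Q`. -/
def ampLeft [CompleteSpace H] [CompleteSpace K] {A : Type*} [NonUnitalCStarAlgebra A]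
    (π : A →⋆ₙₐ[ℂ] (H →L[ℂ] H)) {Q : K →L[ℂ] K} (hQ : IsStarProjection Q) :
    A →⋆ₙₐ[ℂ] (HilbertTensor H K →L[ℂ] HilbertTensor H K) where
  toFun a := tensorOp (π a) Q
  map_smul' c a := by simp [tensorOp_smul_left]
  map_zero' := by simpa using tensorOp_smul_left 0 (0 : H →L[ℂ] H) Q
  map_add' a b := by simp [tensorOp_add_left]
  map_mul' a b := by rw [tensorOp_mul, map_mul, hQ.isIdempotentElem.eq]
  map_star' a := by rw [star_tensorOp, map_star, hQ.isSelfAdjoint.star_eq]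

lemma ampLeft_apply [CompleteSpace H] [CompleteSpace K] {A : Type*} [NonUnitalCStarAlgebra A]
    (π : A →⋆ₙₐ[ℂ] (H →L[ℂ] H)) {Q : K →L[ℂ] K} (h : IsStarProjection Q) (a : A) :
    ampLeft π h a = tensorOp (π a) Q := rfl

/-- Amplification `b ↦ P ⊗ π(b)` of a representation by a projection `P`. -/
def ampRight [CompleteSpace H] [CompleteSpace K] {B : Type*} [NonUnitalCStarAlgebra B]
    (π : B →⋆ₙₐ[ℂ] (K →L[ℂ] K)) {P : H →L[ℂ] H} (hP : IsStarProjection P) :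
    B →⋆ₙₐ[ℂ] (HilbertTensor H K →L[ℂ] HilbertTensor H K) where
  toFun b := tensorOp P (π b)
  map_smul' c a := by simp [tensorOp_smul_right]
  map_zero' := by simpa using tensorOp_smul_right 0 P (0 : K →L[ℂ] K)
  map_add' a b := by simp [tensorOp_add_right]
  map_mul' a b := by rw [tensorOp_mul, map_mul, hP.isIdempotentElem.eq]
  map_star' a := by rw [star_tensorOp, map_star, hP.isSelfAdjoint.star_eq]

lemma ampRight_apply [CompleteSpace H] [CompleteSpace K] {A : Type*} [NonUnitalCStarAlgebra A]
    (π : A →⋆ₙₐ[ℂ] (K →L[ℂ] K)) {P : H →L[ℂ] H} (h : IsStarProjection P) (a : A) :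
    ampRight π h a = tensorOp P (π a) := rfl

/-- If `S ⊗ T = S' ⊗ T'`, then `T` and `T'` are proportional, with coefficients that depend only
on `S`, `S'`. -/
lemma inner_smul_eq_of_tensorOp_eq {S S' : H →L[ℂ] H} {T T' : K →L[ℂ] K}
    (h : tensorOp S T = tensorOp S' T') (ξ ζ : H) : ⟪ζ, S ξ⟫_ℂ • T = ⟪ζ, S' ξ⟫_ℂ • T' := by
  ext η
  refine ext_inner_left ℂ fun ω => ?_
  -- The matrix coefficient between ξ ⊗ η and ζ ⊗ ω factors into one on H and one on K.
  have h1 := congrArg (fun V : HilbertTensor H K →L[ℂ] HilbertTensor H K =>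
    ⟪((ζ ⊗ₜ[ℂ] ω : H ⊗[ℂ] K) : HilbertTensor H K),
      V ((ξ ⊗ₜ[ℂ] η : H ⊗[ℂ] K) : HilbertTensor H K)⟫_ℂ) h
  simpa [inner_smul_right, UniformSpace.Completion.inner_coe] using h1

end Tensor

/-! ### Separating products in A *_D B by tensor product representations. -/

section FreeProduct

variable {A : Type*} {B : Type*} {D : Type*}
  [NonUnitalCStarAlgebra A] [NonUnitalCStarAlgebra B] [NonUnitalCStarAlgebra D]
  (φA : D →⋆ₙₐ[ℂ] A) (φB : D →⋆ₙₐ[ℂ] B)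

/-- The product e*e equals e* because e is a unit, and it is self-adjoint, so e* = e. -/
lemma isStarProjection_of_isIdentity {e : A} (he : IsIdentity e) : IsStarProjection e := by
  refine ⟨(he e).1, ?_⟩
  have h := (he (star e)).2
  have h' := congrArg star h
  rw [star_mul, star_star] at h'
  exact h.symm.trans h'

/-- Representations of `A` and `B` admit supporting projections whose tensor product carries the
images of `D`, if `D` is `0` or consists of scalars. -/
lemma exists_projections
    (hD : Subsingleton D ∨ ∃ e : ℂ ≃⋆ₐ[ℂ] D, IsIdentity (φA (e 1)) ∧ IsIdentity (φB (e 1)))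
    {E F : Type*} [CStarAlgebra E] [CStarAlgebra F] (πA : A →⋆ₙₐ[ℂ] E) (πB : B →⋆ₙₐ[ℂ] F) :
    ∃ (P : E) (Q : F), IsStarProjection P ∧ IsStarProjection Q ∧ (∀ a, πA a * P = πA a) ∧
      (∀ b, Q * πB b = πB b) ∧
      ∀ d, ∃ z : ℂ, πA (φA d) = z • P ∧ πB (φB d) = z • Q := by
  rcases hD with hD | ⟨e, heA, heB⟩
  · refine ⟨1, 1, .one _, .one _, by simp, by simp, fun d => ⟨0, ?_⟩⟩
    simp [Subsingleton.elim d 0]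
  -- P and Q are the images of the units; they need not be 1, since the representations may be
  -- degenerate.
  · refine ⟨_, _, (isStarProjection_of_isIdentity heA).map πA,
      (isStarProjection_of_isIdentity heB).map πB, fun a => ?_, fun b => ?_,
      fun d => ⟨e.symm d, ?_⟩⟩
    · rw [← map_mul, (heA a).2]
    · rw [← map_mul, (heB b).1]
    · have hd : d = e.symm d • e 1 := by rw [← map_smul]; simp
      constructor
      · conv_lhs => rw [hd]
        simp only [map_smul]
      · conv_lhs => rw [hd]
        simp only [map_smul]

variable {φA φB} in
-- A relation in A *_D B passes to every compatible pair by the universal property.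
lemma map_mul_map_eq_of_inl_mul_inr_eq {a a' : A} {b b' : B}
    (h : inl φA φB a' * inr φA φB b = inl φA φB a * inr φA φB b')
    {C : Type*} [NonUnitalCStarAlgebra C] (πA : A →⋆ₙₐ[ℂ] C) (πB : B →⋆ₙₐ[ℂ] C)
    (hπ : ∀ d, πA (φA d) = πB (φB d)) : πA a' * πB b = πA a * πB b' := by
  have key := congrArg (lift φA φB πA πB hπ) h
  simpa only [map_mul, lift_inl, lift_inr] using key

/-- If `D` is `0` or `ℂ`, then products `a * b` in the free product behave like elementary tensors:
`a' * b = a * b'` with `a' ≠ 0` is possible only if `b` is a scalar multiple of `b'`. -/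
theorem exists_smul_eq_of_inl_mul_inr_eq
    (hD : Subsingleton D ∨ ∃ e : ℂ ≃⋆ₐ[ℂ] D, IsIdentity (φA (e 1)) ∧ IsIdentity (φB (e 1)))
    {a a' : A} {b b' : B} (ha' : a' ≠ 0)
    (h : inl φA φB a' * inr φA φB b = inl φA φB a * inr φA φB b') :
    ∃ s t : ℂ, s ≠ 0 ∧ s • b = t • b' := by
  obtain ⟨H, _, _, _, πA, hπA⟩ := exists_representation_ne_zero ha'
  obtain ⟨ξ, hξ⟩ := DFunLike.ne_iff.1 hπA
  -- These are the coefficients of π_A(a') and π_A(a) between ξ and π_A(a')ξ. They involve only A,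
  -- so π_B can be chosen afterwards to detect s·b - t·b'.
  refine ⟨⟪πA a' ξ, πA a' ξ⟫_ℂ, ⟪πA a' ξ, πA a ξ⟫_ℂ, inner_self_ne_zero.2 hξ, ?_⟩
  by_contra hne
  obtain ⟨K, _, _, _, πB, hπB⟩ := exists_representation_ne_zero (sub_ne_zero.2 hne)
  obtain ⟨P, Q, hP, hQ, hAP, hQB, hφ⟩ := exists_projections φA φB hD πA πB
  have hcomm (d : D) : ampLeft πA hQ (φA d) = ampRight πB hP (φB d) := by
    obtain ⟨z, hzA, hzB⟩ := hφ d
    -- On D both amplifications are the same multiple z of P ⊗ Q.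
    change tensorOp (πA (φA d)) Q = tensorOp P (πB (φB d))
    rw [hzA, hzB, tensorOp_smul_left, tensorOp_smul_right]
  have key :=
    map_mul_map_eq_of_inl_mul_inr_eq h (C := HilbertTensor H K →L[ℂ] HilbertTensor H K)
      (ampLeft πA hQ) (ampRight πB hP) hcomm
  rw [ampLeft_apply, ampLeft_apply, ampRight_apply, ampRight_apply,
    tensorOp_mul, tensorOp_mul, hAP, hAP, hQB, hQB] at key
  apply hπB
  rw [map_sub, map_smul, map_smul, sub_eq_zero]
  exact inner_smul_eq_of_tensorOp_eq key ξ _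

end FreeProduct

end FullFree

end

/-! ### Non-injectivity of λ. -/

theorem corollary3p4
    {A B D At Bt Dt : Type*}
    [NonUnitalCStarAlgebra A] [NonUnitalCStarAlgebra B] [NonUnitalCStarAlgebra D]
    [NonUnitalCStarAlgebra At] [NonUnitalCStarAlgebra Bt] [NonUnitalCStarAlgebra Dt]
    -- the two rows of the diagram of inclusions
    (φA : D →⋆ₙₐ[ℂ] A) (φB : D →⋆ₙₐ[ℂ] B)
    (φAt : Dt →⋆ₙₐ[ℂ] At) (φBt : Dt →⋆ₙₐ[ℂ] Bt)
    (hφA : Function.Injective φA) (hφB : Function.Injective φB)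
    (hφAt : Function.Injective φAt) (hφBt : Function.Injective φBt)
    -- the vertical inclusions
    (lA : A →⋆ₙₐ[ℂ] At) (lB : B →⋆ₙₐ[ℂ] Bt) (lD : D →⋆ₙₐ[ℂ] Dt)
    (hlA : Function.Injective lA) (hlB : Function.Injective lB) (hlD : Function.Injective lD)
    (hA : ∀ d, lA (φA d) = φAt (lD d)) (hB : ∀ d, lB (φB d) = φBt (lD d))
    -- either `D = 0`, or `D = ℂ` and its unit is sent to units of `A` and `B`
    (hD : Subsingleton D ∨
      ∃ e : ℂ ≃⋆ₐ[ℂ] D, FullFree.IsIdentity (φA (e 1)) ∧ FullFree.IsIdentity (φB (e 1)))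
    (hex : ∃ (d : Dt) (a : A) (b : B),
      (lA a * φAt d ∈ Set.range lA ∧ lA a * φAt d ≠ 0) ∧
      φBt d * lB b ∈ Set.range lB ∧
      φBt d * lB b ∉ Submodule.span ℂ {lB b}) :
    ¬ Function.Injective (FullFree.map φA φB φAt φBt lA lB lD hA hB) := by
  intro hinj
  obtain ⟨d, a, b, ⟨⟨a', ha'⟩, hne⟩, ⟨b', hb'⟩, hspan⟩ := hex
  have hl (x : A) : FullFree.map φA φB φAt φBt lA lB lD hA hB (FullFree.inl φA φB x) =
      FullFree.inl φAt φBt (lA x) := FullFree.lift_inl ..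
  have hr (y : B) : FullFree.map φA φB φAt φBt lA lB lD hA hB (FullFree.inr φA φB y) =
      FullFree.inr φAt φBt (lB y) := FullFree.lift_inr ..
  have heq : FullFree.inl φA φB a' * FullFree.inr φA φB b =
      FullFree.inl φA φB a * FullFree.inr φA φB b' := by
    -- Both sides have image a·d·b: d moves across through the amalgamation over the larger algebra.
    apply hinj
    rw [map_mul, map_mul, hl, hl, hr, hr, ha', hb', map_mul, map_mul, FullFree.inl_comp_eq,
      mul_assoc]
  have ha0 : a' ≠ 0 := by
    rintro rfl
    exact hne (by rw [← ha', map_zero])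
  obtain ⟨s, t, hs, hst⟩ := FullFree.exists_smul_eq_of_inl_mul_inr_eq φA φB hD ha0 heq
  rw [← hb'] at hspan
  apply hspan
  -- If t = 0, then b = 0, hence b' = d·b = 0, which lies in every span.
  have ht : t ≠ 0 := by
    rintro rfl
    have hb : b = 0 := by simpa [hs] using hst
    have : b' = 0 := hlB (by rw [hb', hb, map_zero, mul_zero])
    exact hspan (by simp [this])
  refine Submodule.mem_span_singleton.2 ⟨t⁻¹ * s, ?_⟩
  rw [← map_smul, mul_smul, hst, smul_smul, inv_mul_cancel₀ ht, one_smul]
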